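/- Let $\mathcal X$ be a measurable space, let $\mathcal D$ be a probability distribution on $\mathcal X\times\{-1,+1\}$, and let $\mathcal H$ be a class of measurable functions $\mathcal X\to\{-1,+1\}$ with finite VC dimension $d_{VC}(\mathcal H)$. Let $\ell(t,y)=-\log\frac{1}{1+e^{-yt}}=\log(1+e^{-yt})$ ($t\in\mathbb R$, $y\in\{-1,+1\}$) be the binary cross-entropy (logistic) loss. For $g:\mathcal X\to\mathbb R$ measurable write $\mathcal R(g)=\mathbb E_{(\mathbf z,y)\sim\mathcal D}[\ell(g(\mathbf z),y)]$, and for a sample $(\mathbf z_i,y_i)_{i=1}^N$ write $\widehat{\mathcal R}(g)=\frac1N\sum_{i=1}^N\ell(g(\mathbf z_i),y_i)$. There is a universal constant $B>0$ such that for all such $\mathcal X,\mathcal D,\mathcal H$, all $N\ge 1$ and all $\delta\in(0,1)$ the following holds. Let $f_1,f_2\in\mathcal H$, let $\eta:\mathcal X\to[0,1]$ be measurable, and let $f(\mathbf z)=\eta(\mathbf z)f_1(\mathbf z)+(1-\eta(\mathbf z))f_2(\mathbf z)$. Then with probability at least $1-\delta$ over an i.i.d. sample $(\mathbf z_i,y_i)_{i=1}^N$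 from $\mathcal D$, $$\mathcal R(f)\le B\sqrt{\frac{d_{VC}(\mathcal H)+\log(1/\delta)}{N}}+\widehat{\mathcal R}(f_1)+\widehat{\mathcal R}(f_2)+\operatorname{Cov}\bigl(\eta(\mathbf z),\,\ell(f_1(\mathbf z),y)-\ell(f_2(\mathbf z),y)\bigr),$$ where the covariance is taken under $(\mathbf z,y)\sim\mathcal D$. Moreover, with the same $B$, there is an event of probability at least $1-\delta$ on which this inequality holds simultaneously for all $f_1,f_2\in\mathcal H$ and all measurable $\eta:\mathcal X\to[0,1]$ (so that these may be chosen depending on the sample), provided that $\mathcal H$ satisfies the following measurability condition: for every $n$ and every $b\in\{-1,+1\}^n$, the set $\{(\mathbf z_1,\dots,\mathbf z_n)\in\mathcal X^n : \exists h\in\mathcal H,\ h(\mathbf z_i)=b_i \text{ for all } i\}$ is measurable up to a null set of the $n$-fold product of the marginal of $\mathcal D$ on $\mathcal X$ (for example, this holds when $\mathcal H$ is countable). -/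

import Mathlib

open MeasureTheory ProbabilityTheory

noncomputable section

/-- The two-point set `{-1, +1}` of binary labels, as a subtype of the reals. -/
abbrev PMOne : Type := ↥({-1, 1} : Set ℝ)

/-- A class `H` of `{-1, +1}`-valued functions shatters the finite set `s` if every labelling of
the points of `s` is realized by a member of `H`. -/
def ClassShatters {X : Type*} (H : Set (X → PMOne)) (s : Finset X) : Prop :=
  ∀ b : X → PMOne, ∃ h ∈ H, ∀ x ∈ s, h x = b x

/-- The Vapnik-Chervonenkis dimension: the supremum of the sizes of the shattered finite sets. -/
def classVCDim {X : Type*} (H : Set (X → PMOne)) : ℕ∞ :=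
  ⨆ (s : Finset X) (_ : ClassShatters H s), (s.card : ℕ∞)

/-- The (binary) cross-entropy loss, i.e. the logistic loss: `-log` of the probability
`sigmoid (y * t)` that the score `t` gives to the true label `y`. It equals
`log (1 + exp (-y * t))`. -/
def crossEntropyLoss (t : ℝ) (y : PMOne) : ℝ :=
  -Real.log (Real.sigmoid ((y : ℝ) * t))

/-- The true risk `𝔼_{(z, y) ∼ D} [ℓ (g z, y)]` of a real-valued predictor. -/
def trueRisk {X : Type*} [MeasurableSpace X] (D : Measure (X × PMOne)) (g : X → ℝ) : ℝ :=
  ∫ p, crossEntropyLoss (g p.1) p.2 ∂D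

/-- The empirical risk `(1 / N) ∑ i, ℓ (g (z i), y i)` of a real-valued predictor on a sample. -/
def empiricalRisk {X : Type*} {N : ℕ} (S : Fin N → X × PMOne) (g : X → ℝ) : ℝ :=
  (1 / (N : ℝ)) * ∑ i, crossEntropyLoss (g (S i).1) (S i).2

/-- The sample-wise mixture `z ↦ η z * f₁ z + (1 - η z) * f₂ z` of two binary predictors. -/
def mixture {X : Type*} (η : X → ℝ) (f₁ f₂ : X → PMOne) : X → ℝ :=
  fun z => η z * (f₁ z : ℝ) + (1 - η z) * (f₂ z : ℝ)

/-- The measurability that uniform statements over a possibly uncountable class take for granted: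
for `n` independent points drawn from `μ` and any labelling `b`, "some member of `H` labels the
points by `b`" is an event (up to a null set). It holds, for every `μ`, for every countable class
of measurable functions. -/
def TraceMeasurable {X : Type*} [MeasurableSpace X] (H : Set (X → PMOne)) (μ : Measure X) : Prop :=
  ∀ (n : ℕ) (b : Fin n → PMOne),
    NullMeasurableSet {z : Fin n → X | ∃ h ∈ H, ∀ i, h (z i) = b i} (Measure.pi fun _ => μ)

end

/-!
A `{-1, +1}`-valued predictor has logistic loss `log (1 + e⁻¹)` on the examples it classifies
correctly and exactly `1` more on the others. Its risk and its empirical risk are therefore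
`log (1 + e⁻¹)` plus the expectation and the mean of its zero-one loss.

By convexity of the loss, the risk of the mixture is at most `m * R f₁ + (1 - m) * R f₂ + cov`,
where `m` is the mean of `η` (`trueRisk_mixture_le`). The claimed bound contains the sum of the two
empirical risks in place of their mean with weights `m` and `1 - m`. The difference is again a
weighted mean of empirical risks, so at least `log (1 + e⁻¹) > 1 / 4`. Deviations between risk and
empirical risk thus need to be controlled only down to the fixed size `1 / 4`
(`trueRisk_mixture_le_empiricalRisk`).

With `B = 40`, the square root term is at least `1` when `N < 1600 * (d + log (1 / δ))`, and then
nothing is left to prove, the zero-one loss being at most `1`. For larger `N`, deviations of more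
than `1 / 4` have probability at most `δ`. For two fixed predictors this is Hoeffding's inequality.
Uniformly over the class it is the theorem of Vapnik and Chervonenkis: a ghost sample and random
exchanges between the two samples reduce the claim to the signs bound `card_signs_le`, summed over
the labellings of the `2 * N` points, whose number the Sauer-Shelah lemma bounds by
`∑ k ≤ d, (2 * N).choose k` (`measure_ghostDeviation_le`). As the deviation is of constant
size and `N` a large multiple of `d`, this crude union bound suffices and no chaining is needed.

The class may be uncountable, and the samples on which some member deviates need not form an event.
Their outer measure is bounded instead; measurability of the labellings is needed only for the event
that compares the two samples.
-/

/-! ### The logistic loss -/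

lemma crossEntropyLoss_eq (t : ℝ) (y : PMOne) :
    crossEntropyLoss t y = Real.log (1 + Real.exp (-((y : ℝ) * t))) := by
  rw [crossEntropyLoss, Real.sigmoid_def, Real.log_inv, neg_neg]

lemma PMOne.coe_eq (y : PMOne) : (y : ℝ) = -1 ∨ (y : ℝ) = 1 := y.2

lemma PMOne.eq_of_ne_of_ne {a b c : PMOne} (hab : a ≠ b) (hac : a ≠ c) : b = c := by
  have h1 : (a : ℝ) ≠ b := fun h => hab (Subtype.ext h)
  have h2 : (a : ℝ) ≠ c := fun h => hac (Subtype.ext h)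
  apply Subtype.ext
  rcases a.coe_eq with ha | ha <;> rcases b.coe_eq with hb | hb <;>
    rcases c.coe_eq with hc | hc <;> simp_all

/-- The derivative of `x ↦ -log (sigmoid x)` is `sigmoid x - 1`, which is increasing. -/
lemma convexOn_neg_log_sigmoid :
    ConvexOn ℝ Set.univ fun x : ℝ => -Real.log (Real.sigmoid x) := by
  have hderiv (x : ℝ) :
      HasDerivAt (fun x : ℝ => -Real.log (Real.sigmoid x)) (Real.sigmoid x - 1) x := by
    have hx := (Real.sigmoid_pos x).ne'
    convert! ((Real.hasDerivAt_sigmoid x).log hx).neg using 1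
    field_simp
    ring
  refine MonotoneOn.convexOn_of_deriv convex_univ
    (fun x _ => (hderiv x).continuousAt.continuousWithinAt)
    (fun x _ => (hderiv x).differentiableAt.differentiableWithinAt) ?_
  intro x _ y _ hxy
  rw [(hderiv x).deriv, (hderiv y).deriv]
  linarith [Real.sigmoid_le hxy]

lemma crossEntropyLoss_convexComb_le {a : ℝ} (ha : a ∈ Set.Icc (0 : ℝ) 1) (s t : ℝ) (y : PMOne) :
    crossEntropyLoss (a * s + (1 - a) * t) y ≤
      a * crossEntropyLoss s y + (1 - a) * crossEntropyLoss t y := by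
  have h := convexOn_neg_log_sigmoid.2 (Set.mem_univ ((y : ℝ) * s)) (Set.mem_univ ((y : ℝ) * t))
    ha.1 (sub_nonneg.2 ha.2) (by ring)
  simp only [smul_eq_mul] at h
  have h2 : (y : ℝ) * (a * s + (1 - a) * t) = a * (y * s) + (1 - a) * (y * t) := by ring
  rw [crossEntropyLoss, h2]
  exact h

lemma measurable_crossEntropyLoss {X : Type*} [MeasurableSpace X] {g : X → ℝ}
    (hg : Measurable g) : Measurable fun p : X × PMOne => crossEntropyLoss (g p.1) p.2 := by
  unfold crossEntropyLoss
  have h : Measurable fun p : X × PMOne => (p.2 : ℝ) * g p.1 := by fun_prop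
  exact (Real.measurable_log.comp (continuous_sigmoid.measurable.comp h)).neg

/-- The loss `1` of a misclassified and `0` of a correctly classified example. -/
noncomputable def zeroOneLoss {X : Type*} (h : X → PMOne) (p : X × PMOne) : ℝ :=
  if h p.1 = p.2 then 0 else 1

section ZeroOne

variable {X : Type*}

lemma zeroOneLoss_mem_Icc (h : X → PMOne) (p : X × PMOne) :
    zeroOneLoss h p ∈ Set.Icc (0 : ℝ) 1 := by
  unfold zeroOneLoss
  split_ifs <;> simp

/-- The logistic losses `log (1 + e)` and `log (1 + e⁻¹)` of a wrong and of a right label differ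
by exactly `1`. -/
lemma crossEntropyLoss_eq_add_zeroOneLoss (h : X → PMOne) (p : X × PMOne) :
    crossEntropyLoss (h p.1 : ℝ) p.2 = Real.log (1 + Real.exp (-1)) + zeroOneLoss h p := by
  have key : Real.log (1 + Real.exp 1) = Real.log (1 + Real.exp (-1)) + 1 := by
    have h1 : 1 + Real.exp 1 = (1 + Real.exp (-1)) * Real.exp 1 := by
      rw [add_mul, ← Real.exp_add]; simp [add_comm]
    rw [h1, Real.log_mul (by positivity) (by positivity), Real.log_exp]
  rw [crossEntropyLoss_eq, zeroOneLoss]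
  simp only [Subtype.ext_iff]
  rcases (h p.1).coe_eq with ha | ha <;> rcases p.2.coe_eq with hb | hb <;> rw [ha, hb] <;>
    norm_num [key]

lemma empiricalRisk_eq {N : ℕ} (hN : 0 < N) (S : Fin N → X × PMOne) (h : X → PMOne) :
    empiricalRisk S (fun z => (h z : ℝ)) =
      Real.log (1 + Real.exp (-1)) + (1 / (N : ℝ)) * ∑ i, zeroOneLoss h (S i) := by
  have : (N : ℝ) ≠ 0 := by positivity
  simp only [empiricalRisk, crossEntropyLoss_eq_add_zeroOneLoss, Finset.sum_add_distrib]
  simp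
  field_simp

lemma quarter_le_log : (1 : ℝ) / 4 ≤ Real.log (1 + Real.exp (-1)) := by
  have he : (0.36 : ℝ) ≤ Real.exp (-1) := by
    rw [Real.exp_neg]
    have := Real.exp_one_lt_d9
    rw [le_inv_comm₀ (by norm_num) (Real.exp_pos 1)]
    norm_num
    linarith
  have h1 := Real.one_sub_inv_le_log_of_pos (show (0 : ℝ) < 1 + Real.exp (-1) by positivity)
  have h2 : (1 + Real.exp (-1))⁻¹ ≤ (1.36 : ℝ)⁻¹ := inv_anti₀ (by norm_num) (by linarith)
  norm_num at h2 ⊢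
  linarith

variable [MeasurableSpace X]

lemma measurable_zeroOneLoss {h : X → PMOne} (hh : Measurable h) : Measurable (zeroOneLoss h) := by
  unfold zeroOneLoss
  exact Measurable.ite (measurableSet_eq_fun (hh.comp measurable_fst) measurable_snd)
    measurable_const measurable_const

variable {D : Measure (X × PMOne)} [IsProbabilityMeasure D]

lemma integrable_zeroOneLoss {h : X → PMOne} (hh : Measurable h) :
    Integrable (zeroOneLoss h) D :=
  .of_mem_Icc 0 1 (measurable_zeroOneLoss hh).aemeasurable (ae_of_all _ (zeroOneLoss_mem_Icc h))

lemma trueRisk_eq {h : X → PMOne} (hh : Measurable h) :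
    trueRisk D (fun z => (h z : ℝ)) =
      Real.log (1 + Real.exp (-1)) + ∫ p, zeroOneLoss h p ∂D := by
  simp only [trueRisk, crossEntropyLoss_eq_add_zeroOneLoss]
  rw [integral_add (integrable_const _) (integrable_zeroOneLoss hh)]
  simp

/-- Convexity of the loss bounds the risk of the mixture by the mean of
`η * ℓ₁ + (1 - η) * ℓ₂ = ℓ₂ + η * (ℓ₁ - ℓ₂)`; the covariance is what replacing `η` by its mean
costs. -/
lemma trueRisk_mixture_le {f₁ f₂ : X → PMOne} (h₁ : Measurable f₁) (h₂ : Measurable f₂)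
    {η : X → ℝ} (hη : Measurable η) (hη' : ∀ z, η z ∈ Set.Icc (0 : ℝ) 1) :
    trueRisk D (mixture η f₁ f₂) ≤
      (∫ p, η p.1 ∂D) * trueRisk D (fun z => (f₁ z : ℝ))
        + (1 - ∫ p, η p.1 ∂D) * trueRisk D (fun z => (f₂ z : ℝ))
        + cov[fun p : X × PMOne => η p.1,
            fun p : X × PMOne =>
              crossEntropyLoss (f₁ p.1 : ℝ) p.2 - crossEntropyLoss (f₂ p.1 : ℝ) p.2; D] := by
  have m₁ : Measurable fun z => (f₁ z : ℝ) := measurable_subtype_coe.comp h₁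
  have m₂ : Measurable fun z => (f₂ z : ℝ) := measurable_subtype_coe.comp h₂
  have hmem (p : X × PMOne) (f : X → PMOne) : crossEntropyLoss (f p.1 : ℝ) p.2 ∈
      Set.Icc (Real.log (1 + Real.exp (-1))) (Real.log (1 + Real.exp (-1)) + 1) := by
    rw [crossEntropyLoss_eq_add_zeroOneLoss]
    have := zeroOneLoss_mem_Icc f p
    exact ⟨by linarith [this.1], by linarith [this.2]⟩
  have L₁ : MemLp (fun p : X × PMOne => crossEntropyLoss (f₁ p.1 : ℝ) p.2) 2 D :=
    memLp_of_bounded (ae_of_all _ fun p => hmem p f₁)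
      (measurable_crossEntropyLoss m₁).aestronglyMeasurable 2
  have L₂ : MemLp (fun p : X × PMOne => crossEntropyLoss (f₂ p.1 : ℝ) p.2) 2 D :=
    memLp_of_bounded (ae_of_all _ fun p => hmem p f₂)
      (measurable_crossEntropyLoss m₂).aestronglyMeasurable 2
  have Lη : MemLp (fun p : X × PMOne => η p.1) 2 D :=
    memLp_of_bounded (ae_of_all _ fun p : X × PMOne => hη' p.1)
      (hη.comp measurable_fst).aestronglyMeasurable 2
  have I₁ := L₁.integrable one_le_two
  have I₂ := L₂.integrable one_le_two
  have Iη : Integrable ((fun p : X × PMOne => η p.1) *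
      ((fun p : X × PMOne => crossEntropyLoss (f₁ p.1 : ℝ) p.2) -
        fun p : X × PMOne => crossEntropyLoss (f₂ p.1 : ℝ) p.2)) D :=
    Lη.integrable_mul (L₁.sub L₂)
  have hcov := covariance_eq_sub Lη (L₁.sub L₂)
  have hsub : ∫ p, ((fun p : X × PMOne => crossEntropyLoss (f₁ p.1 : ℝ) p.2) -
      fun p : X × PMOne => crossEntropyLoss (f₂ p.1 : ℝ) p.2) p ∂D =
      trueRisk D (fun z => (f₁ z : ℝ)) - trueRisk D (fun z => (f₂ z : ℝ)) :=
    integral_sub I₁ I₂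
  rw [hsub] at hcov
  have hle (p : X × PMOne) : crossEntropyLoss (mixture η f₁ f₂ p.1) p.2 ≤
      ((fun p : X × PMOne => η p.1) *
      ((fun p : X × PMOne => crossEntropyLoss (f₁ p.1 : ℝ) p.2) -
        fun p : X × PMOne => crossEntropyLoss (f₂ p.1 : ℝ) p.2)) p +
        crossEntropyLoss (f₂ p.1 : ℝ) p.2 := by
    have := crossEntropyLoss_convexComb_le (hη' p.1) (f₁ p.1) (f₂ p.1) p.2
    simp only [Pi.mul_apply, Pi.sub_apply, mixture]
    linarith
  have hnonneg (p : X × PMOne) : 0 ≤ crossEntropyLoss (mixture η f₁ f₂ p.1) p.2 := by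
    rw [crossEntropyLoss_eq]
    exact Real.log_nonneg (by linarith [Real.exp_pos (-((p.2 : ℝ) * mixture η f₁ f₂ p.1))])
  have hint := integral_mono_of_nonneg (μ := D) (ae_of_all _ hnonneg) (Iη.add I₂) (ae_of_all _ hle)
  have hadd := integral_add Iη I₂
  have hR : trueRisk D (mixture η f₁ f₂) ≤ _ := hint.trans hadd.le
  change _ ≤ _ + trueRisk D (fun z => (f₂ z : ℝ)) at hR
  change cov[fun p : X × PMOne => η p.1, fun p : X × PMOne =>
    crossEntropyLoss (f₁ p.1 : ℝ) p.2 - crossEntropyLoss (f₂ p.1 : ℝ) p.2; D] = _ at hcov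
  linarith

end ZeroOne

/-! ### Hoeffding's inequality and random signs -/

/-- **Hoeffding's inequality** for the mean of `N` independent copies of a `[0, 1]`-valued random
variable falling below its expectation. -/
lemma hoeffding_lower_tail {Z : Type*} [MeasurableSpace Z] {D : Measure Z}
    [IsProbabilityMeasure D] {f : Z → ℝ} (hf : Measurable f) (hf' : ∀ z, f z ∈ Set.Icc (0 : ℝ) 1)
    (N : ℕ) {t : ℝ} (ht : 0 ≤ t) :
    (Measure.pi fun _ : Fin N => D).real
        {S | N * t ≤ ∑ i, (∫ z, f z ∂D - f (S i))} ≤ Real.exp (-(2 * N * t ^ 2)) := by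
  rcases N.eq_zero_or_pos with rfl | hN
  · simp
  have hind : iIndepFun (fun (i : Fin N) (S : Fin N → Z) => ∫ z, f z ∂D - f (S i))
      (Measure.pi fun _ : Fin N => D) :=
    iIndepFun_pi (X := fun _ z => ∫ z, f z ∂D - f z) fun _ => (hf.const_sub _).aemeasurable
  have hsub (i : Fin N) : HasSubgaussianMGF (fun S : Fin N → Z => ∫ z, f z ∂D - f (S i))
      ((‖(0 : ℝ) - (-1)‖₊ / 2) ^ 2) (Measure.pi fun _ : Fin N => D) := by
    have h := hasSubgaussianMGF_of_mem_Icc (μ := Measure.pi fun _ : Fin N => D)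
      (X := fun S : Fin N → Z => -f (S i)) (a := -1) (b := 0)
      (hf.comp (measurable_pi_apply i)).neg.aemeasurable
      (ae_of_all _ fun S => ⟨by linarith [(hf' (S i)).2], by linarith [(hf' (S i)).1]⟩)
    have hint : ∫ S : Fin N → Z, -f (S i) ∂(Measure.pi fun _ : Fin N => D) = -∫ z, f z ∂D := by
      rw [integral_neg]
      congr 1
      have := measurePreserving_eval (fun _ : Fin N => D) i
      calc ∫ S : Fin N → Z, f (S i) ∂(Measure.pi fun _ : Fin N => D)
          = ∫ z, f z ∂((Measure.pi fun _ : Fin N => D).map (Function.eval i)) :=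
            (integral_map (measurable_pi_apply i).aemeasurable hf.aestronglyMeasurable).symm
        _ = ∫ z, f z ∂D := by rw [this.map_eq]
    rw [hint] at h
    convert h using 2
    ring
  have := HasSubgaussianMGF.measure_sum_ge_le_of_iIndepFun hind (s := Finset.univ)
    (fun i _ => hsub i) (ε := N * t) (by positivity)
  refine this.trans (Real.exp_le_exp.2 (le_of_eq ?_))
  have : (N : ℝ) ≠ 0 := by positivity
  simp
  field_simp

/-- Chernoff's bound for random signs, as a count of sign patterns. -/
lemma card_signs_le {ι : Type*} [Fintype ι] [DecidableEq ι] {c : ι → ℝ} (hc : ∀ i, |c i| ≤ 1)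
    (t : ℝ) (ht : 0 ≤ t) :
    ((Finset.univ.filter fun σ : ι → Bool =>
        Fintype.card ι * t < ∑ i, (if σ i then -c i else c i)).card : ℝ) ≤
      2 ^ Fintype.card ι * Real.exp (-(Fintype.card ι * t ^ 2 / 2)) := by
  set n := Fintype.card ι
  have hprod : ∑ σ : ι → Bool, ∏ i, Real.exp (t * (if σ i then -c i else c i)) =
      ∏ i, ∑ b : Bool, Real.exp (t * (if b then -c i else c i)) := by
    rw [Finset.prod_univ_sum, Fintype.piFinset_univ]
  have hfactor (i : ι) : ∑ b : Bool, Real.exp (t * (if b then -c i else c i)) ≤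
      2 * Real.exp (t ^ 2 / 2) := by
    have h1 : ∑ b : Bool, Real.exp (t * (if b then -c i else c i)) = 2 * Real.cosh (t * c i) := by
      simp [Real.cosh_eq]; ring
    rw [h1]
    have h2 := Real.cosh_le_exp_half_sq (t * c i)
    have h3 : (t * c i) ^ 2 ≤ t ^ 2 := by
      rw [mul_pow]
      exact mul_le_of_le_one_right (sq_nonneg t) ((sq_le_one_iff_abs_le_one _).2 (hc i))
    have h4 : Real.exp ((t * c i) ^ 2 / 2) ≤ Real.exp (t ^ 2 / 2) :=
      Real.exp_le_exp.2 (by linarith)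
    linarith
  calc ((Finset.univ.filter fun σ : ι → Bool =>
        n * t < ∑ i, (if σ i then -c i else c i)).card : ℝ)
      ≤ ∑ σ : ι → Bool, Real.exp (t * (∑ i, (if σ i then -c i else c i)) - n * t ^ 2) := by
        rw [← Finset.sum_boole]
        refine Finset.sum_le_sum fun σ _ => ?_
        split_ifs with h
        · exact Real.one_le_exp (by nlinarith)
        · positivity
    _ = (∑ σ : ι → Bool, ∏ i, Real.exp (t * (if σ i then -c i else c i))) *
          Real.exp (-(n * t ^ 2)) := by
        rw [Finset.sum_mul]
        refine Finset.sum_congr rfl fun σ _ => ?_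
        rw [← Real.exp_sum, ← Real.exp_add, ← Finset.mul_sum, sub_eq_add_neg]
    _ ≤ (∏ _i : ι, (2 * Real.exp (t ^ 2 / 2))) * Real.exp (-(n * t ^ 2)) := by
        rw [hprod]
        gcongr with i
        exact hfactor i
    _ = 2 ^ n * Real.exp (-(n * t ^ 2 / 2)) := by
        rw [Finset.prod_const, Finset.card_univ, mul_pow, ← Real.exp_nat_mul, mul_assoc,
          ← Real.exp_add]
        congr 2
        ring

/-! ### Traces of a class of finite VC dimension -/

open Classical in
/-- The labellings that `H` induces on the points `z i`, each encoded as the set of the indices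
labelled `1`. The points may coincide, so this is a family of sets of indices. -/
noncomputable def traceFamily {X ι : Type*} [Fintype ι] (H : Set (X → PMOne)) (z : ι → X) :
    Finset (Finset ι) :=
  Finset.univ.filter fun T => ∃ h ∈ H, ∀ i, i ∈ T ↔ (h (z i) : ℝ) = 1

lemma PMOne.eq_of_eq_one_iff {a b : PMOne} (h : (a : ℝ) = 1 ↔ (b : ℝ) = 1) : a = b := by
  apply Subtype.ext
  rcases a.coe_eq with ha | ha <;> rcases b.coe_eq with hb | hb <;> simp_all

section Traces

variable {X : Type*} {H : Set (X → PMOne)} {d : ℕ}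

lemma card_le_of_classShatters (hd : classVCDim H ≤ d) {s : Finset X} (hs : ClassShatters H s) :
    s.card ≤ d := by
  have : (s.card : ℕ∞) ≤ classVCDim H := le_iSup₂_of_le s hs le_rfl
  exact_mod_cast this.trans hd

lemma eq_of_classVCDim_eq_zero (hd : classVCDim H = 0) {h h' : X → PMOne} (hh : h ∈ H)
    (hh' : h' ∈ H) : h = h' := by
  by_contra hne
  obtain ⟨x, hx⟩ := Function.ne_iff.1 hne
  have hs : ClassShatters H {x} := by
    intro b
    by_cases hb : h x = b x
    · exact ⟨h, hh, by simpa using hb⟩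
    · exact ⟨h', hh', by simpa using PMOne.eq_of_ne_of_ne hx hb⟩
  simpa using card_le_of_classShatters (d := 0) (by simp [hd]) hs

variable {ι : Type*} [Fintype ι] [DecidableEq ι]

/-- A set of indices shattered by the traces consists of distinct points, and `H` shatters
these. -/
lemma card_le_of_traceFamily_shatters (hd : classVCDim H ≤ d) {z : ι → X} {s : Finset ι}
    (hs : (traceFamily H z).Shatters s) : s.card ≤ d := by
  classical
  have key (t : Finset ι) (ht : t ⊆ s) : ∃ h ∈ H, ∀ i ∈ s, i ∈ t ↔ (h (z i) : ℝ) = 1 := by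
    obtain ⟨u, hu, rfl⟩ := hs ht
    simp only [traceFamily, Finset.mem_filter, Finset.mem_univ, true_and] at hu
    obtain ⟨h, hh, hu⟩ := hu
    exact ⟨h, hh, fun i hi => by simp [hi, hu]⟩
  have hinj : Set.InjOn z s := by
    intro i hi j hj hij
    obtain ⟨h, -, hh⟩ := key {i} (by simpa using hi)
    have h1 := (hh i hi).1 (by simp)
    rw [hij] at h1
    exact (Finset.mem_singleton.1 ((hh j hj).2 h1)).symm
  rw [← Finset.card_image_of_injOn hinj]
  refine card_le_of_classShatters hd fun b => ?_
  obtain ⟨h, hh, hb⟩ := key (s.filter fun i => (b (z i) : ℝ) = 1) (Finset.filter_subset _ _)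
  refine ⟨h, hh, ?_⟩
  intro x hx
  obtain ⟨i, hi, rfl⟩ := Finset.mem_image.1 hx
  have := hb i hi
  simp only [Finset.mem_filter, hi, true_and] at this
  exact (PMOne.eq_of_eq_one_iff this).symm

/-- The **Sauer-Shelah lemma** for traces. -/
lemma card_traceFamily_le (hd : classVCDim H ≤ d) (z : ι → X) :
    (traceFamily H z).card ≤ ∑ k ∈ Finset.Iic d, (Fintype.card ι).choose k := by
  refine (traceFamily H z).card_le_card_shatterer.trans
    (Finset.card_shatterer_le_sum_vcDim.trans ?_)
  refine Finset.sum_le_sum_of_subset (Finset.Iic_subset_Iic.2 ?_)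
  exact Finset.sup_le fun s hs =>
    card_le_of_traceFamily_shatters hd (Finset.mem_shatterer.1 hs)

end Traces

/-- Weighting the `k`-th term of the binomial expansion of `(1 + x) ^ n` by `x ^ (d - k) ≤ 1`. -/
lemma pow_mul_sum_choose_le (n d : ℕ) {x : ℝ} (hx : 0 ≤ x) (hx1 : x ≤ 1) :
    x ^ d * ∑ k ∈ Finset.Iic d, (n.choose k : ℝ) ≤ (1 + x) ^ n := by
  have h1 : (1 + x) ^ n = ∑ k ∈ Finset.range (n + d + 1), x ^ k * (n.choose k : ℝ) := by
    rw [add_comm, add_pow]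
    simp only [one_pow, mul_one]
    refine Finset.sum_subset (Finset.range_subset_range.2 (by omega)) fun k _ hk => ?_
    rw [Nat.choose_eq_zero_of_lt (by simpa using hk)]
    simp
  rw [h1, Finset.mul_sum]
  calc ∑ k ∈ Finset.Iic d, x ^ d * (n.choose k : ℝ)
      ≤ ∑ k ∈ Finset.Iic d, x ^ k * (n.choose k : ℝ) := by
        refine Finset.sum_le_sum fun k hk => ?_
        have := pow_le_pow_of_le_one hx hx1 (Finset.mem_Iic.1 hk)
        gcongr
    _ ≤ _ := by
        refine Finset.sum_le_sum_of_subset_of_nonneg (fun k hk => ?_) fun _ _ _ => by positivity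
        have := Finset.mem_Iic.1 hk
        simp only [Finset.mem_range]
        omega

/-! ### Symmetrization by a ghost sample -/

/-- Averaging over a finite family of measure-preserving maps: if no point is sent into `E` by more
than `K` of them, then `E` has measure at most `K` divided by their number. -/
lemma card_mul_measure_le {Ω σ : Type*} [MeasurableSpace Ω] [Fintype σ] {μ : Measure Ω}
    [IsProbabilityMeasure μ] {T : σ → Ω → Ω} (hT : ∀ s, MeasurePreserving (T s) μ μ) {E : Set Ω}
    (hE : NullMeasurableSet E μ) [∀ w, DecidablePred fun s => T s w ∈ E] {K : ENNReal}
    (hK : ∀ w, ((Finset.univ.filter fun s => T s w ∈ E).card : ENNReal) ≤ K) :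
    Fintype.card σ * μ E ≤ K := by
  classical
  have hTE (s : σ) : NullMeasurableSet (T s ⁻¹' E) μ :=
    hE.preimage (hT s).quasiMeasurePreserving
  calc Fintype.card σ * μ E = ∑ s, μ (T s ⁻¹' E) := by
        simp [(hT _).measure_preimage hE]
    _ = ∑ s, ∫⁻ w, (T s ⁻¹' E).indicator 1 w ∂μ := by
        simp_rw [lintegral_indicator_one₀ (hTE _)]
    _ = ∫⁻ w, ∑ s, (T s ⁻¹' E).indicator 1 w ∂μ :=
        (lintegral_finsetSum' _ fun s _ => aemeasurable_const.indicator₀ (hTE s)).symm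
    _ ≤ ∫⁻ _, K ∂μ := by
        refine lintegral_mono fun w => (le_of_eq ?_).trans (hK w)
        simp [Set.indicator_apply, Finset.sum_boole]
    _ = K := by simp

section Symmetrization

variable {X : Type*}

/-- The pairs of samples of size `N` for which the mean zero-one loss of some member of `H` is more
than `t` larger on the second sample than on the first. -/
def ghostDeviation (H : Set (X → PMOne)) (N : ℕ) (t : ℝ) :
    Set (Fin N → (X × PMOne) × (X × PMOne)) :=
  {w | ∃ h ∈ H, N * t < ∑ i, (zeroOneLoss h (w i).2 - zeroOneLoss h (w i).1)}

/-- The samples of size `N` on which the mean zero-one loss of some member of `H` is more than `ε`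
below its expectation. -/
def deviatingSamples [MeasurableSpace X] (D : Measure (X × PMOne)) (H : Set (X → PMOne)) (N : ℕ)
    (ε : ℝ) : Set (Fin N → X × PMOne) :=
  {S | ∃ h ∈ H, N * ε < ∑ i, (∫ p, zeroOneLoss h p ∂D - zeroOneLoss h (S i))}

/-- The `N` pairs with those exchanged that `σ` selects. -/
def swapPairs {Z : Type*} {N : ℕ} (σ : Fin N → Bool) (w : Fin N → Z × Z) : Fin N → Z × Z :=
  fun i => if σ i then (w i).swap else w i

/-- The points of the two samples in a single list. -/
def samplePoints {N : ℕ} (w : Fin N → (X × PMOne) × (X × PMOne)) : Fin (N + N) → X :=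
  Fin.append (fun i => (w i).1.1) (fun i => (w i).2.1)

/-- Given the two samples, a swap pattern makes `H` deviate only if one of the labellings
induced by `H` deviates, and each of these does so for few patterns. -/
lemma card_swapPairs_mem_le {H : Set (X → PMOne)} {d : ℕ} (hd : classVCDim H ≤ d) {N : ℕ}
    {t : ℝ} (ht : 0 ≤ t) (w : Fin N → (X × PMOne) × (X × PMOne))
    [DecidablePred fun σ => swapPairs σ w ∈ ghostDeviation H N t] :
    ((Finset.univ.filter fun σ => swapPairs σ w ∈ ghostDeviation H N t).card : ℝ) ≤
      (∑ k ∈ Finset.Iic d, (2 * N).choose k : ℕ) * (2 ^ N * Real.exp (-(N * t ^ 2 / 2))) := by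
  classical
  set z : Fin N ⊕ Fin N → X := Sum.elim (fun i => (w i).1.1) (fun i => (w i).2.1) with hz
  -- the signed contribution of the `i`-th pair, as a function of the labelled indices
  let c (T : Finset (Fin N ⊕ Fin N)) (i : Fin N) : ℝ :=
    (if (Sum.inr i ∈ T ↔ ((w i).2.2 : ℝ) = 1) then 0 else 1) -
      (if (Sum.inl i ∈ T ↔ ((w i).1.2 : ℝ) = 1) then 0 else 1)
  have hc (T) (i) : |c T i| ≤ 1 := by
    simp only [c]
    split_ifs <;> norm_num
  have hloss (h : X → PMOne) (p : X × PMOne) :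
      zeroOneLoss h p = if ((h p.1 : ℝ) = 1 ↔ (p.2 : ℝ) = 1) then 0 else 1 := by
    rw [zeroOneLoss]
    congr 1
    exact propext ⟨fun e => by rw [e], PMOne.eq_of_eq_one_iff⟩
  have hsub : (Finset.univ.filter fun σ => swapPairs σ w ∈ ghostDeviation H N t) ⊆
      (traceFamily H z).biUnion fun T => Finset.univ.filter fun σ : Fin N → Bool =>
        Fintype.card (Fin N) * t < ∑ i, (if σ i then -c T i else c T i) := by
    intro σ hσ
    obtain ⟨h, hh, hlt⟩ := (Finset.mem_filter.1 hσ).2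
    refine Finset.mem_biUnion.2 ⟨Finset.univ.filter fun i => (h (z i) : ℝ) = 1, ?_, ?_⟩
    · simp only [traceFamily, Finset.mem_filter, Finset.mem_univ, true_and]
      exact ⟨h, hh, fun i => Iff.rfl⟩
    · simp only [Finset.mem_filter, Finset.mem_univ, true_and, Fintype.card_fin]
      refine hlt.trans_le (le_of_eq (Finset.sum_congr rfl fun i _ => ?_))
      cases hs : σ i <;> simp [swapPairs, hs, c, hloss, hz]
  have hcard : ∀ T ∈ traceFamily H z, ((Finset.univ.filter fun σ : Fin N → Bool =>
        Fintype.card (Fin N) * t < ∑ i, (if σ i then -c T i else c T i)).card : ℝ) ≤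
      2 ^ N * Real.exp (-(N * t ^ 2 / 2)) := fun T _ => by
    simpa only [Fintype.card_fin] using card_signs_le (hc T) t ht
  have hfam : (traceFamily H z).card ≤ ∑ k ∈ Finset.Iic d, (2 * N).choose k := by
    simpa [two_mul] using card_traceFamily_le hd z
  calc ((Finset.univ.filter fun σ => swapPairs σ w ∈ ghostDeviation H N t).card : ℝ)
      ≤ ∑ T ∈ traceFamily H z, ((Finset.univ.filter fun σ : Fin N → Bool =>
        Fintype.card (Fin N) * t < ∑ i, (if σ i then -c T i else c T i)).card : ℝ) := by
        exact_mod_cast (Finset.card_le_card hsub).trans Finset.card_biUnion_le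
    _ ≤ (traceFamily H z).card * (2 ^ N * Real.exp (-(N * t ^ 2 / 2))) := by
        simpa only [nsmul_eq_mul] using Finset.sum_le_card_nsmul _ _ _ hcard
    _ ≤ _ := by gcongr

lemma measurePreserving_swapPairs {Z : Type*} [MeasurableSpace Z] {D : Measure Z}
    [IsProbabilityMeasure D] {N : ℕ} (σ : Fin N → Bool) :
    MeasurePreserving (swapPairs σ) (Measure.pi fun _ : Fin N => D.prod D)
      (Measure.pi fun _ : Fin N => D.prod D) := by
  refine measurePreserving_pi (fun _ : Fin N => D.prod D) (fun _ : Fin N => D.prod D)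
    (f := fun i p => if σ i then p.swap else p) fun i => ?_
  by_cases h : σ i
  · simpa [h] using Measure.measurePreserving_swap
  · simpa [h] using! MeasurePreserving.id (D.prod D)

variable [MeasurableSpace X]

lemma measurePreserving_samplePoints (D : Measure (X × PMOne)) [IsProbabilityMeasure D] (N : ℕ) :
    MeasurePreserving (samplePoints (N := N)) (Measure.pi fun _ => D.prod D)
      (Measure.pi fun _ => D.fst) := by
  have hm : Measurable (samplePoints (X := X) (N := N)) := by
    refine measurable_pi_lambda _ fun i => ?_
    refine Fin.addCases (fun j => ?_) (fun j => ?_) i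
    · simp only [samplePoints, Fin.append_left]; fun_prop
    · simp only [samplePoints, Fin.append_right]; fun_prop
  refine ⟨hm, (Measure.pi_eq fun s hs => ?_).symm⟩
  rw [Measure.map_apply hm (.univ_pi hs)]
  have hpre : samplePoints (N := N) ⁻¹' Set.univ.pi s =
      Set.univ.pi fun i => (Prod.fst ⁻¹' s (Fin.castAdd N i)) ×ˢ
        (Prod.fst ⁻¹' s (Fin.natAdd N i)) := by
    ext w
    simp only [Set.mem_preimage, Set.mem_univ_pi, Set.mem_prod]
    constructor
    · intro h i
      have h1 := h (Fin.castAdd N i)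
      have h2 := h (Fin.natAdd N i)
      simp only [samplePoints, Fin.append_left, Fin.append_right] at h1 h2
      exact ⟨h1, h2⟩
    · intro h i
      refine Fin.addCases (fun j => ?_) (fun j => ?_) i
      · simpa only [samplePoints, Fin.append_left] using (h j).1
      · simpa only [samplePoints, Fin.append_right] using (h j).2
  rw [hpre, Measure.pi_pi, Fin.prod_univ_add, ← Finset.prod_mul_distrib]
  refine Finset.prod_congr rfl fun i _ => ?_
  rw [Measure.prod_prod, Measure.fst_apply (hs _), Measure.fst_apply (hs _)]

/-- Whether a member of `H` deviates depends only on its labelling of the sample points, so that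
the event is a finite union over labellings. -/
lemma nullMeasurableSet_ghostDeviation {D : Measure (X × PMOne)} [IsProbabilityMeasure D]
    {H : Set (X → PMOne)} (hH : TraceMeasurable H D.fst) (N : ℕ) (t : ℝ) :
    NullMeasurableSet (ghostDeviation H N t) (Measure.pi fun _ => D.prod D) := by
  have heq : ghostDeviation H N t = ⋃ b : Fin (N + N) → PMOne,
      (samplePoints ⁻¹' {z | ∃ h ∈ H, ∀ i, h (z i) = b i}) ∩
        {w | N * t < ∑ i, (zeroOneLoss (fun _ : Unit => b (Fin.natAdd N i)) ((), (w i).2.2) -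
          zeroOneLoss (fun _ : Unit => b (Fin.castAdd N i)) ((), (w i).1.2))} := by
    ext w
    simp only [ghostDeviation, Set.mem_ofPred_eq, Set.mem_iUnion, Set.mem_inter_iff,
      Set.mem_preimage, zeroOneLoss]
    constructor
    · rintro ⟨h, hh, hw⟩
      refine ⟨fun i => h (samplePoints w i), ⟨h, hh, fun _ => rfl⟩, ?_⟩
      simpa only [samplePoints, Fin.append_left, Fin.append_right] using hw
    · rintro ⟨b, ⟨h, hh, hb⟩, hw⟩
      refine ⟨h, hh, ?_⟩
      simp only [← hb] at hw
      simpa only [samplePoints, Fin.append_left, Fin.append_right] using hw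
  rw [heq]
  refine NullMeasurableSet.iUnion fun b => NullMeasurableSet.inter
    ((hH (N + N) b).preimage (measurePreserving_samplePoints D N).quasiMeasurePreserving)
    (MeasurableSet.nullMeasurableSet (measurableSet_lt measurable_const ?_))
  refine Finset.measurable_sum _ fun i _ => Measurable.sub ?_ ?_
  · exact (measurable_zeroOneLoss measurable_const).comp (by fun_prop)
  · exact (measurable_zeroOneLoss measurable_const).comp (by fun_prop)

lemma measure_ghostDeviation_le {D : Measure (X × PMOne)} [IsProbabilityMeasure D]
    {H : Set (X → PMOne)} (hH : TraceMeasurable H D.fst) {d : ℕ} (hd : classVCDim H ≤ d) (N : ℕ)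
    {t : ℝ} (ht : 0 ≤ t) :
    (Measure.pi fun _ => D.prod D) (ghostDeviation H N t) ≤
      ENNReal.ofReal
        ((∑ k ∈ Finset.Iic d, (2 * N).choose k : ℕ) * Real.exp (-(N * t ^ 2 / 2))) := by
  classical
  have h := card_mul_measure_le (fun σ : Fin N → Bool => measurePreserving_swapPairs (D := D) σ)
    (nullMeasurableSet_ghostDeviation hH N t)
    (K := ENNReal.ofReal ((∑ k ∈ Finset.Iic d, (2 * N).choose k : ℕ) *
      (2 ^ N * Real.exp (-(N * t ^ 2 / 2))))) fun w => by
        rw [← ENNReal.ofReal_natCast]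
        exact ENNReal.ofReal_le_ofReal (card_swapPairs_mem_le hd ht w)
  have hpow : (Fintype.card (Fin N → Bool) : ENNReal) = ENNReal.ofReal (2 ^ N) := by
    rw [← ENNReal.ofReal_natCast]; simp
  rw [hpow, mul_left_comm, ENNReal.ofReal_mul (by positivity)] at h
  exact (ENNReal.mul_le_mul_iff_right (by simp) ENNReal.ofReal_ne_top).1 h

/-- The bad samples are not assumed to form an event: their outer measure is bounded. To
each of them, at least half of the second samples exhibit a deviation of half the size. -/
lemma measure_deviatingSamples_le_two_mul {D : Measure (X × PMOne)} [IsProbabilityMeasure D]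
    {H : Set (X → PMOne)} (hm : ∀ h ∈ H, Measurable h) {N : ℕ} {t : ℝ} (ht : 0 ≤ t)
    (hN : Real.exp (-(2 * N * t ^ 2)) ≤ 1 / 2)
    (hE : NullMeasurableSet (ghostDeviation H N t) (Measure.pi fun _ => D.prod D)) :
    (Measure.pi fun _ : Fin N => D) (deviatingSamples D H N (2 * t)) ≤
      2 * (Measure.pi fun _ => D.prod D) (ghostDeviation H N t) := by
  set P := Measure.pi fun _ : Fin N => D
  have he := measurePreserving_arrowProdEquivProdArrow (X × PMOne) (X × PMOne) (Fin N)
    (fun _ => D) (fun _ => D)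
  set e := MeasurableEquiv.arrowProdEquivProdArrow (X × PMOne) (X × PMOne) (Fin N)
  have hE' : NullMeasurableSet (e.symm ⁻¹' ghostDeviation H N t) (P.prod P) :=
    hE.preimage (he.symm e).quasiMeasurePreserving
  obtain ⟨F, hEF, hF, hFE⟩ : ∃ F ⊇ e.symm ⁻¹' ghostDeviation H N t, MeasurableSet F ∧
      (P.prod P) F = (P.prod P) (e.symm ⁻¹' ghostDeviation H N t) :=
    ⟨_, subset_toMeasurable _ _, measurableSet_toMeasurable _ _, measure_toMeasurable _⟩
  rw [(he.symm e).measure_preimage hE] at hFE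
  have hhalf : deviatingSamples D H N (2 * t) ⊆ {S | 1 / 2 ≤ P (Prod.mk S ⁻¹' F)} := by
    rintro S ⟨h, hh, hS⟩
    set V : Set (Fin N → X × PMOne) :=
      {S' | N * t ≤ ∑ i, (∫ p, zeroOneLoss h p ∂D - zeroOneLoss h (S' i))} with hV
    have hVm : MeasurableSet V :=
      measurableSet_le measurable_const (Finset.measurable_sum _ fun i _ =>
        ((measurable_zeroOneLoss (hm h hh)).comp (measurable_pi_apply i)).const_sub _)
    have hVle : P V ≤ 1 / 2 := by
      have h1 := (hoeffding_lower_tail (D := D) (measurable_zeroOneLoss (hm h hh))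
        (zeroOneLoss_mem_Icc h) N ht).trans hN
      have h2 := (ENNReal.le_ofReal_iff_toReal_le (measure_ne_top P V) (by norm_num)).2 h1
      refine h2.trans (le_of_eq ?_)
      rw [ENNReal.ofReal_div_of_pos (by norm_num)]
      simp
    have hsub : Vᶜ ⊆ Prod.mk S ⁻¹' F := by
      intro S' hS'
      refine hEF ⟨h, hh, ?_⟩
      have hS'' : ∑ i, (∫ p, zeroOneLoss h p ∂D - zeroOneLoss h (S' i)) < N * t := by
        simpa [hV] using hS'
      change N * t < ∑ i, (zeroOneLoss h (S' i) - zeroOneLoss h (S i))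
      simp only [Finset.sum_sub_distrib] at hS hS'' ⊢
      linarith
    refine le_trans ?_ (measure_mono hsub)
    rw [prob_compl_eq_one_sub hVm]
    calc (1 / 2 : ENNReal) = 1 - 1 / 2 := by simp
      _ ≤ 1 - P V := tsub_le_tsub_left hVle 1
  refine (measure_mono hhalf).trans ?_
  have hmarkov := mul_meas_ge_le_lintegral (μ := P) (measurable_measure_prodMk_left (ν := P) hF)
    (1 / 2)
  rw [← Measure.prod_apply hF, hFE] at hmarkov
  calc P {S | 1 / 2 ≤ P (Prod.mk S ⁻¹' F)}
      = 2 * (1 / 2 * P {S | 1 / 2 ≤ P (Prod.mk S ⁻¹' F)}) := by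
        rw [← mul_assoc]
        simp [ENNReal.mul_inv_cancel]
    _ ≤ _ := by gcongr

end Symmetrization

/-! ### Uniform deviations of constant size -/

section Deviation

variable {X : Type*} [MeasurableSpace X] {D : Measure (X × PMOne)} [IsProbabilityMeasure D]
  {H : Set (X → PMOne)} {N : ℕ}

lemma measure_deviatingSamples_singleton_le {h : X → PMOne} (hh : Measurable h) :
    (Measure.pi fun _ : Fin N => D) (deviatingSamples D {h} N (1 / 4)) ≤
      ENNReal.ofReal (Real.exp (-(N / 8))) := by
  have h1 := hoeffding_lower_tail (D := D) (measurable_zeroOneLoss hh) (zeroOneLoss_mem_Icc h) N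
    (t := 1 / 4) (by norm_num)
  have h2 := (ENNReal.le_ofReal_iff_toReal_le (measure_ne_top _ _) (Real.exp_pos _).le).2 h1
  refine (measure_mono ?_).trans (h2.trans (ENNReal.ofReal_le_ofReal (Real.exp_le_exp.2 ?_)))
  · rintro S ⟨_, rfl, hS⟩
    exact hS.le
  · linarith

lemma measure_deviatingSamples_le_of_classVCDim_eq_zero (hm : ∀ h ∈ H, Measurable h)
    (hd : classVCDim H = 0) :
    (Measure.pi fun _ : Fin N => D) (deviatingSamples D H N (1 / 4)) ≤
      ENNReal.ofReal (Real.exp (-(N / 8))) := by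
  rcases H.eq_empty_or_nonempty with rfl | ⟨h, hh⟩
  · simp [deviatingSamples]
  · refine (measure_mono ?_).trans (measure_deviatingSamples_singleton_le (hm h hh))
    rintro S ⟨h', hh', hS⟩
    exact ⟨h', eq_of_classVCDim_eq_zero hd hh' hh, hS⟩

/-- If `N` is a large multiple of `d + log (1 / δ)`, the Sauer-Shelah bound, at most
`800 ^ d * (1 + 1 / 800) ^ (2 * N)`, is beaten by the exponential factor. -/
lemma two_mul_sum_choose_mul_exp_le {d : ℕ} (hd : 1 ≤ d) {δ : ℝ} (hδ : 0 < δ) (hδ1 : δ < 1)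
    (hN : 1600 * (d + Real.log (1 / δ)) ≤ N) :
    2 * ((∑ k ∈ Finset.Iic d, (2 * N).choose k : ℕ) * Real.exp (-(N * (1 / 8) ^ 2 / 2))) ≤ δ := by
  have hL : 0 < Real.log (1 / δ) := Real.log_pos ((one_lt_div hδ).2 hδ1)
  have hd' : (1 : ℝ) ≤ d := by exact_mod_cast hd
  have h800 : (800 : ℝ) ≤ Real.exp 7 := by
    have h1 := Real.exp_one_gt_d9
    have h2 : Real.exp 7 = Real.exp 1 ^ 7 := by rw [← Real.exp_nat_mul]; norm_num
    rw [h2]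
    calc (800 : ℝ) ≤ 2.7 ^ 7 := by norm_num
      _ ≤ Real.exp 1 ^ 7 := pow_le_pow_left₀ (by norm_num) (by linarith) 7
  have hsum : ((∑ k ∈ Finset.Iic d, (2 * N).choose k : ℕ) : ℝ) ≤
      Real.exp (7 * d) * Real.exp (N / 400) := by
    have h1 := pow_mul_sum_choose_le (2 * N) d (x := 1 / 800) (by norm_num) (by norm_num)
    have h2 : (1 + 1 / 800 : ℝ) ^ (2 * N) ≤ Real.exp (N / 400) := by
      calc (1 + 1 / 800 : ℝ) ^ (2 * N) ≤ Real.exp (1 / 800) ^ (2 * N) := by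
            refine pow_le_pow_left₀ (by norm_num) ?_ _
            linarith [Real.add_one_le_exp (1 / 800 : ℝ)]
        _ = Real.exp (N / 400) := by
            rw [← Real.exp_nat_mul]
            push_cast
            ring_nf
    have h3 : (800 : ℝ) ^ d ≤ Real.exp (7 * d) := by
      calc (800 : ℝ) ^ d ≤ Real.exp 7 ^ d := by gcongr
        _ = Real.exp (7 * d) := by rw [← Real.exp_nat_mul, mul_comm]
    push_cast
    calc ∑ k ∈ Finset.Iic d, ((2 * N).choose k : ℝ)
        = 800 ^ d * ((1 / 800) ^ d * ∑ k ∈ Finset.Iic d, ((2 * N).choose k : ℝ)) := by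
          rw [← mul_assoc, ← mul_pow]; norm_num
      _ ≤ Real.exp (7 * d) * Real.exp (N / 400) := by
          gcongr
          exact h1.trans h2
  have h2 : (2 : ℝ) ≤ Real.exp d := by linarith [Real.add_one_le_exp (d : ℝ)]
  calc 2 * ((∑ k ∈ Finset.Iic d, (2 * N).choose k : ℕ) * Real.exp (-(N * (1 / 8) ^ 2 / 2)))
      ≤ Real.exp d * ((Real.exp (7 * d) * Real.exp (N / 400)) *
          Real.exp (-(N * (1 / 8) ^ 2 / 2))) := by gcongr
    _ = Real.exp (d + (7 * d + N / 400 + -(N * (1 / 8) ^ 2 / 2))) := by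
        simp only [Real.exp_add]
    _ ≤ Real.exp (Real.log δ) := by
        rw [Real.exp_le_exp]
        rw [one_div, Real.log_inv] at hN hL
        linarith
    _ = δ := Real.exp_log hδ

lemma exp_neg_div_eight_le {a : ℝ} {δ : ℝ} (hδ : 0 < δ) (ha : 8 * (a + Real.log (1 / δ)) ≤ N) :
    Real.exp (-(N / 8)) ≤ Real.exp (-a) * δ := by
  rw [one_div, Real.log_inv] at ha
  calc Real.exp (-(N / 8)) ≤ Real.exp (-a + Real.log δ) := Real.exp_le_exp.2 (by linarith)
    _ = _ := by rw [Real.exp_add, Real.exp_log hδ]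

lemma measure_deviatingSamples_le (hm : ∀ h ∈ H, Measurable h) {d : ℕ} (hd : classVCDim H = d)
    (hH : TraceMeasurable H D.fst) {δ : ℝ} (hδ : 0 < δ) (hδ1 : δ < 1)
    (hN : 1600 * (d + Real.log (1 / δ)) ≤ N) :
    (Measure.pi fun _ : Fin N => D) (deviatingSamples D H N (1 / 4)) ≤ ENNReal.ofReal δ := by
  have hL : 0 < Real.log (1 / δ) := Real.log_pos ((one_lt_div hδ).2 hδ1)
  -- For `d = 0` the prefactor of the symmetrization bound would spoil it for `δ` near `1`.
  rcases d.eq_zero_or_pos with rfl | hd1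
  · refine (measure_deviatingSamples_le_of_classVCDim_eq_zero hm (by simpa using hd)).trans
      (ENNReal.ofReal_le_ofReal ?_)
    simpa using exp_neg_div_eight_le (a := 0) hδ (by push_cast at hN; linarith)
  have hd' : (1 : ℝ) ≤ d := by exact_mod_cast hd1
  have hexp : Real.exp (-(2 * N * (1 / 8 : ℝ) ^ 2)) ≤ 1 / 2 := by
    rw [Real.exp_neg, one_div (2 : ℝ)]
    refine inv_anti₀ (by norm_num) ?_
    linarith [Real.add_one_le_exp (2 * N * (1 / 8 : ℝ) ^ 2)]
  have h1 := measure_deviatingSamples_le_two_mul hm (by norm_num) hexp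
    (nullMeasurableSet_ghostDeviation hH N (1 / 8))
  have h2 := measure_ghostDeviation_le hH hd.le N (t := 1 / 8) (by norm_num)
  have h3 : (2 : ℝ) * (1 / 8) = 1 / 4 := by norm_num
  rw [h3] at h1
  refine h1.trans ((mul_le_mul_right h2 2).trans ?_)
  have h4 : (2 : ENNReal) = ENNReal.ofReal 2 := by simp
  rw [h4, ← ENNReal.ofReal_mul (by norm_num)]
  exact ENNReal.ofReal_le_ofReal (two_mul_sum_choose_mul_exp_le hd1 hδ hδ1 hN)

lemma measure_deviatingSamples_pair_le (hm : ∀ h ∈ H, Measurable h) {d : ℕ}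
    (hd : classVCDim H = d) {f₁ f₂ : X → PMOne} (h₁ : f₁ ∈ H) (h₂ : f₂ ∈ H) {δ : ℝ} (hδ : 0 < δ)
    (hδ1 : δ < 1) (hN : 1600 * (d + Real.log (1 / δ)) ≤ N) :
    (Measure.pi fun _ : Fin N => D) (deviatingSamples D {f₁, f₂} N (1 / 4)) ≤
      ENNReal.ofReal δ := by
  have hL : 0 < Real.log (1 / δ) := Real.log_pos ((one_lt_div hδ).2 hδ1)
  by_cases hf : f₁ = f₂
  · subst hf
    have hd0 : (0 : ℝ) ≤ d := by positivity
    rw [Set.pair_eq_singleton]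
    refine (measure_deviatingSamples_singleton_le (hm f₁ h₁)).trans (ENNReal.ofReal_le_ofReal ?_)
    simpa using exp_neg_div_eight_le (a := 0) hδ (by linarith)
  · have hd1 : 1 ≤ d := by
      by_contra h0
      obtain rfl : d = 0 := by omega
      exact hf (eq_of_classVCDim_eq_zero (by simpa using hd) h₁ h₂)
    have hd' : (1 : ℝ) ≤ d := by exact_mod_cast hd1
    have hδ2 : Real.exp (-(N / 8)) ≤ δ / 2 := by
      refine (exp_neg_div_eight_le (a := 1) hδ (by linarith)).trans ?_
      have : Real.exp (-1) ≤ 1 / 2 := by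
        rw [Real.exp_neg, one_div]
        exact inv_anti₀ (by norm_num) (by linarith [Real.add_one_le_exp (1 : ℝ)])
      nlinarith
    have hunion : deviatingSamples D {f₁, f₂} N (1 / 4) ⊆
        deviatingSamples D {f₁} N (1 / 4) ∪ deviatingSamples D {f₂} N (1 / 4) := by
      rintro S ⟨h, rfl | rfl, hS⟩
      · exact Or.inl ⟨h, rfl, hS⟩
      · exact Or.inr ⟨h, rfl, hS⟩
    calc _ ≤ _ := (measure_mono hunion).trans (measure_union_le _ _)
      _ ≤ ENNReal.ofReal (δ / 2) + ENNReal.ofReal (δ / 2) := add_le_add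
          ((measure_deviatingSamples_singleton_le (hm f₁ h₁)).trans
            (ENNReal.ofReal_le_ofReal hδ2))
          ((measure_deviatingSamples_singleton_le (hm f₂ h₂)).trans
            (ENNReal.ofReal_le_ofReal hδ2))
      _ = ENNReal.ofReal δ := by
          rw [← ENNReal.ofReal_add (by positivity) (by positivity), add_halves]

end Deviation

/-! ### The risk of the mixture -/

/-- A set of small outer measure is avoided by an event of large probability. -/
lemma exists_measurableSet_subset_compl {Ω : Type*} [MeasurableSpace Ω] {P : Measure Ω}
    [IsProbabilityMeasure P] {A : Set Ω} {δ : ℝ} (hδ : 0 ≤ δ) (hA : P A ≤ ENNReal.ofReal δ) :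
    ∃ G, MeasurableSet G ∧ ENNReal.ofReal (1 - δ) ≤ P G ∧ ∀ S ∈ G, S ∉ A := by
  refine ⟨(toMeasurable P A)ᶜ, (measurableSet_toMeasurable P A).compl, ?_,
    fun S hS hSA => hS (subset_toMeasurable P A hSA)⟩
  rw [prob_compl_eq_one_sub (measurableSet_toMeasurable P A), measure_toMeasurable,
    ENNReal.ofReal_sub 1 hδ, ENNReal.ofReal_one]
  exact tsub_le_tsub_left hA 1

lemma quarter_le_empiricalRisk {X : Type*} {N : ℕ} (hN : 0 < N) (S : Fin N → X × PMOne)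
    (h : X → PMOne) :
    1 / 4 ≤ empiricalRisk S (fun z => (h z : ℝ)) := by
  have : 0 ≤ (1 / (N : ℝ)) * ∑ i, zeroOneLoss h (S i) :=
    mul_nonneg (by positivity) (Finset.sum_nonneg fun i _ => (zeroOneLoss_mem_Icc h _).1)
  rw [empiricalRisk_eq hN]
  linarith [quarter_le_log]

section Mixture

variable {X : Type*} [MeasurableSpace X] {D : Measure (X × PMOne)} [IsProbabilityMeasure D]
  {N : ℕ}

lemma trueRisk_le_empiricalRisk_add_one (hN : 0 < N) (S : Fin N → X × PMOne) {h : X → PMOne}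
    (hh : Measurable h) :
    trueRisk D (fun z => (h z : ℝ)) ≤ empiricalRisk S (fun z => (h z : ℝ)) + 1 := by
  have h0 : 0 ≤ (1 / (N : ℝ)) * ∑ i, zeroOneLoss h (S i) :=
    mul_nonneg (by positivity) (Finset.sum_nonneg fun i _ => (zeroOneLoss_mem_Icc h _).1)
  have h1 : ∫ p, zeroOneLoss h p ∂D ≤ 1 := by
    simpa using integral_mono (integrable_zeroOneLoss (D := D) hh) (integrable_const (1 : ℝ))
      fun p => (zeroOneLoss_mem_Icc h p).2
  rw [empiricalRisk_eq hN, trueRisk_eq hh]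
  linarith

lemma trueRisk_le_of_notMem_deviatingSamples (hN : 0 < N) {S : Fin N → X × PMOne}
    {H : Set (X → PMOne)} (hS : S ∉ deviatingSamples D H N (1 / 4)) {h : X → PMOne} (hh : h ∈ H)
    (hm : Measurable h) :
    trueRisk D (fun z => (h z : ℝ)) ≤ empiricalRisk S (fun z => (h z : ℝ)) + 1 / 4 := by
  have hle : ∑ i, (∫ p, zeroOneLoss h p ∂D - zeroOneLoss h (S i)) ≤ N * (1 / 4) := by
    by_contra hlt
    exact hS ⟨h, hh, not_le.1 hlt⟩
  have hN' : (0 : ℝ) < N := by positivity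
  rw [empiricalRisk_eq hN, trueRisk_eq hm]
  simp only [Finset.sum_sub_distrib, Finset.sum_const, Finset.card_univ, Fintype.card_fin,
    nsmul_eq_mul] at hle
  have h1 : ∫ p, zeroOneLoss h p ∂D =
      1 / (N : ℝ) * (N * ∫ p, zeroOneLoss h p ∂D - ∑ i, zeroOneLoss h (S i)) +
        1 / (N : ℝ) * ∑ i, zeroOneLoss h (S i) := by
    field_simp
    ring
  have h2 : 1 / (N : ℝ) * (N * ∫ p, zeroOneLoss h p ∂D - ∑ i, zeroOneLoss h (S i)) ≤
      1 / (N : ℝ) * (N * (1 / 4)) := by gcongr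
  have h3 : 1 / (N : ℝ) * (N * (1 / 4)) = 1 / 4 := by field_simp
  linarith

/-- The bound adds up the two empirical risks where a weighted mean would do. The surplus is at
least `log (1 + e⁻¹) ≥ 1 / 4`, the least value of the loss at `±1`, and pays for deviations of
that size. -/
lemma trueRisk_mixture_le_empiricalRisk (hN : 0 < N) {S : Fin N → X × PMOne}
    {f₁ f₂ : X → PMOne} (h₁ : Measurable f₁) (h₂ : Measurable f₂) {η : X → ℝ} (hη : Measurable η)
    (hη' : ∀ z, η z ∈ Set.Icc (0 : ℝ) 1) {r : ℝ}
    (hr₁ : trueRisk D (fun z => (f₁ z : ℝ)) ≤ empiricalRisk S (fun z => (f₁ z : ℝ)) + (1 / 4 + r))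
    (hr₂ : trueRisk D (fun z => (f₂ z : ℝ)) ≤
      empiricalRisk S (fun z => (f₂ z : ℝ)) + (1 / 4 + r)) :
    trueRisk D (mixture η f₁ f₂) ≤
      r + (empiricalRisk S (fun z => (f₁ z : ℝ)) + empiricalRisk S (fun z => (f₂ z : ℝ)))
        + cov[fun p : X × PMOne => η p.1,
            fun p : X × PMOne =>
              crossEntropyLoss (f₁ p.1 : ℝ) p.2 - crossEntropyLoss (f₂ p.1 : ℝ) p.2; D] := by
  have hmix := trueRisk_mixture_le (D := D) h₁ h₂ hη hη'
  set m := ∫ p : X × PMOne, η p.1 ∂D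
  have hm0 : 0 ≤ m := integral_nonneg fun p => (hη' p.1).1
  have hm1 : m ≤ 1 := by
    simpa using integral_mono (μ := D)
      (.of_mem_Icc 0 1 (hη.comp measurable_fst).aemeasurable (ae_of_all _ fun p => hη' p.1))
      (integrable_const (1 : ℝ)) fun p => (hη' p.1).2
  have e₁ := mul_le_mul_of_nonneg_left hr₁ hm0
  have e₂ := mul_le_mul_of_nonneg_left hr₂ (sub_nonneg.2 hm1)
  have e₃ := mul_le_mul_of_nonneg_left (quarter_le_empiricalRisk hN S f₁) (sub_nonneg.2 hm1)
  have e₄ := mul_le_mul_of_nonneg_left (quarter_le_empiricalRisk hN S f₂) hm0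
  linarith

end Mixture

theorem theorem1 :
    ∃ B : ℝ, 0 < B ∧
      ∀ (X : Type*) [MeasurableSpace X] (D : Measure (X × PMOne)) [IsProbabilityMeasure D]
        (H : Set (X → PMOne)) (d : ℕ) (N : ℕ) (δ : ℝ),
        (∀ h ∈ H, Measurable h) → classVCDim H = d → 0 < N → 0 < δ → δ < 1 →
        -- fixed predictors and mixing coefficient
        (∀ f₁ ∈ H, ∀ f₂ ∈ H, ∀ η : X → ℝ, Measurable η → (∀ z, η z ∈ Set.Icc (0 : ℝ) 1) →
          ∃ G : Set (Fin N → X × PMOne), MeasurableSet G ∧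
            ENNReal.ofReal (1 - δ) ≤ Measure.pi (fun _ : Fin N => D) G ∧
            ∀ S ∈ G,
              trueRisk D (mixture η f₁ f₂) ≤
                B * Real.sqrt (((d : ℝ) + Real.log (1 / δ)) / (N : ℝ))
                  + (empiricalRisk S (fun z => (f₁ z : ℝ)) + empiricalRisk S (fun z => (f₂ z : ℝ)))
                  + cov[fun p : X × PMOne => η p.1,
                      fun p : X × PMOne =>
                        crossEntropyLoss (f₁ p.1 : ℝ) p.2 - crossEntropyLoss (f₂ p.1 : ℝ) p.2; D]) ∧
        -- uniformly over the class, so that predictors and coefficient may depend on the sample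
        (TraceMeasurable H D.fst →
          ∃ G : Set (Fin N → X × PMOne), MeasurableSet G ∧
            ENNReal.ofReal (1 - δ) ≤ Measure.pi (fun _ : Fin N => D) G ∧
            ∀ S ∈ G, ∀ f₁ ∈ H, ∀ f₂ ∈ H, ∀ η : X → ℝ, Measurable η →
              (∀ z, η z ∈ Set.Icc (0 : ℝ) 1) →
              trueRisk D (mixture η f₁ f₂) ≤
                B * Real.sqrt (((d : ℝ) + Real.log (1 / δ)) / (N : ℝ))
                  + (empiricalRisk S (fun z => (f₁ z : ℝ)) + empiricalRisk S (fun z => (f₂ z : ℝ)))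
                  + cov[fun p : X × PMOne => η p.1,
                      fun p : X × PMOne =>
                        crossEntropyLoss (f₁ p.1 : ℝ) p.2 - crossEntropyLoss (f₂ p.1 : ℝ) p.2; D]) := by
  refine ⟨40, by norm_num, ?_⟩
  intro X _ D _ H d N δ hm hd hN hδ hδ1
  have hN' : (0 : ℝ) < N := by positivity
  rcases le_or_gt (1600 * ((d : ℝ) + Real.log (1 / δ))) N with hlarge | hsmall
  · have hr : 0 ≤ 40 * Real.sqrt (((d : ℝ) + Real.log (1 / δ)) / (N : ℝ)) := by positivity
    have hdev (S : Fin N → X × PMOne) (K : Set (X → PMOne))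
        (hS : S ∉ deviatingSamples D K N (1 / 4)) (f : X → PMOne) (hf : f ∈ K)
        (hfm : Measurable f) :
        trueRisk D (fun z => (f z : ℝ)) ≤ empiricalRisk S (fun z => (f z : ℝ)) +
          (1 / 4 + 40 * Real.sqrt (((d : ℝ) + Real.log (1 / δ)) / (N : ℝ))) := by
      linarith [trueRisk_le_of_notMem_deviatingSamples hN hS hf hfm]
    refine ⟨fun f₁ h₁ f₂ h₂ η hη hη' => ?_, fun hH => ?_⟩
    · obtain ⟨G, hG, hGδ, hGA⟩ := exists_measurableSet_subset_compl hδ.le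
        (measure_deviatingSamples_pair_le (D := D) hm hd h₁ h₂ hδ hδ1 hlarge)
      exact ⟨G, hG, hGδ, fun S hS => trueRisk_mixture_le_empiricalRisk hN (hm f₁ h₁) (hm f₂ h₂)
        hη hη' (hdev S _ (hGA S hS) f₁ (by simp) (hm f₁ h₁))
        (hdev S _ (hGA S hS) f₂ (by simp) (hm f₂ h₂))⟩
    · obtain ⟨G, hG, hGδ, hGA⟩ := exists_measurableSet_subset_compl hδ.le
        (measure_deviatingSamples_le (D := D) hm hd hH hδ hδ1 hlarge)
      exact ⟨G, hG, hGδ, fun S hS f₁ h₁ f₂ h₂ η hη hη' =>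
        trueRisk_mixture_le_empiricalRisk hN (hm f₁ h₁) (hm f₂ h₂) hη hη'
          (hdev S _ (hGA S hS) f₁ h₁ (hm f₁ h₁)) (hdev S _ (hGA S hS) f₂ h₂ (hm f₂ h₂))⟩
  · -- The sample is so small that the square root term exceeds the range of the loss.
    have hr : 1 ≤ 40 * Real.sqrt (((d : ℝ) + Real.log (1 / δ)) / (N : ℝ)) := by
      have h1 : (1 / 40 : ℝ) ≤ Real.sqrt (((d : ℝ) + Real.log (1 / δ)) / (N : ℝ)) := by
        refine Real.le_sqrt_of_sq_le ?_
        rw [le_div_iff₀ hN']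
        linarith
      linarith
    have hdev (S : Fin N → X × PMOne) (f : X → PMOne) (hf : f ∈ H) :
        trueRisk D (fun z => (f z : ℝ)) ≤ empiricalRisk S (fun z => (f z : ℝ)) +
          (1 / 4 + 40 * Real.sqrt (((d : ℝ) + Real.log (1 / δ)) / (N : ℝ))) := by
      linarith [trueRisk_le_empiricalRisk_add_one (D := D) hN S (hm f hf)]
    have huniv : ENNReal.ofReal (1 - δ) ≤ Measure.pi (fun _ : Fin N => D) Set.univ := by
      rw [measure_univ, ENNReal.ofReal_le_one]
      linarith
    exact ⟨fun f₁ h₁ f₂ h₂ η hη hη' => ⟨Set.univ, .univ, huniv, fun S _ =>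
        trueRisk_mixture_le_empiricalRisk hN (hm f₁ h₁) (hm f₂ h₂) hη hη' (hdev S f₁ h₁)
          (hdev S f₂ h₂)⟩,
      fun _ => ⟨Set.univ, .univ, huniv, fun S _ f₁ h₁ f₂ h₂ η hη hη' =>
        trueRisk_mixture_le_empiricalRisk hN (hm f₁ h₁) (hm f₂ h₂) hη hη' (hdev S f₁ h₁)
          (hdev S f₂ h₂)⟩⟩
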